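/- **LQR robustness margins.** Let $A\in\mathbb R^{n\times n}$, $B\in\mathbb R^{n\times p}$, and let $\|\cdot\|_2$ be the spectral norm. *Controllability.* Put $\mathcal C_k=[B\;AB\;\cdots\;A^{k-1}B]$ and $r_k=\operatorname{rank}\mathcal C_k$ ($r_0=0$). The pair $(A,B)$ is controllable if $r_k=n$ for some $k\le n$; its controllability index is $\kappa=\min\{k\ge 1: r_k=n\}$. *Staircase form.* Split $\mathbb R^n$ into consecutive blocks of sizes $p_i=r_i-r_{i-1}$, $1\le i\le\kappa$. A controllable pair has a staircase form: there is an orthogonal $U$ such that $U'B$ is zero outside its first block row $B_1$, and the blocks $A_{i,j}\in\mathbb R^{p_i\times p_j}$ of $U'AU$ vanish for $i>j+1$. *Robust coupling.* For $\mu>0$, $(A,B)$ is $\mu$-robustly coupled if $\sigma_p(B_1)\ge\mu$ and $\sigma_{p_{i+1}}(A_{i+1,i})\ge\mu$ for all $1\le i\le\kappa-1$, where $\sigma_k$ is the $k$-th largest singular value (these conditions do not depend on the choice of $U$). *Optimal gain for $Q=I_n$, $R=I_p$.* Let $P$ be the positive definite (equivalently, stabilizing) solution of $$P=A'PA+I_n-A'PB(B'PB+I_p)^{-1}B'PA,\qquad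 K_\star=-(B'PB+I_p)^{-1}B'PA .$$ Let $\rho$ denote the spectral radius, and for a matrix $X$ with $\rho(X)<1$ let $\|(zI-X)^{-1}\|_{\mathcal H_\infty}=\sup_{z\in\mathbb C,\,|z|=1}\|(zI-X)^{-1}\|_2$. **Statement.** For every real $c>1$ there is a real polynomial $F$ in three variables, depending only on $c$, such that the following holds for all $n,p$, all $M\ge 1$, $\mu>0$, and every controllable, $\mu$-robustly coupled pair $(A,B)$ with $\|A\|_2,\|B\|_2\le M$ and controllability index $\kappa$. One has $\rho(A+BK_\star)<1$, and $$(1-\rho(A+BK_\star))^{-1}\le F\big((cM/\mu)^\kappa,M^\kappa,\kappa\big),\qquad \|(zI-A-BK_\star)^{-1}\|_{\mathcal H_\infty}\le F\big((cM/\mu)^\kappa,M^\kappa,\kappa\big).$$ If moreover $M\ge c$ or $M/\mu\ge c$, then also $$(1-\rho(A+BK_\star))^{-1}\le F\big((M/\mu)^\kappa,M^\kappa,\kappa\big),\qquad \|(zI-A-BK_\star)^{-1}\|_{\mathcal H_\infty}\le F\big((M/\mu)^\kappa,M^\kappa,\kappa\big).$$ -/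

import Mathlib

open scoped ENNReal Matrix Matrix.Norms.L2Operator

noncomputable section

namespace LQR

/-- The controllability matrix `C_k(A,B) = [B, AB, …, A^{k-1}B]`; its columns are indexed by the
pairs (block, column inside the block). -/
def ctrbMatrix {n p : ℕ} (A : Matrix (Fin n) (Fin n) ℝ) (B : Matrix (Fin n) (Fin p) ℝ) (k : ℕ) :
    Matrix (Fin n) (Fin k × Fin p) ℝ :=
  Matrix.of fun a q => (A ^ (q.1 : ℕ) * B) a q.2

/-- `rank C_k(A,B)`. -/
def ctrbRank {n p : ℕ} (A : Matrix (Fin n) (Fin n) ℝ) (B : Matrix (Fin n) (Fin p) ℝ) (k : ℕ) : ℕ :=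
  (ctrbMatrix A B k).rank

/-- `(A,B)` is controllable: `rank C_k(A,B) = n` for some `k ≤ n`. -/
def Controllable {n p : ℕ} (A : Matrix (Fin n) (Fin n) ℝ) (B : Matrix (Fin n) (Fin p) ℝ) : Prop :=
  ∃ k ≤ n, ctrbRank A B k = n

/-- The controllability index `κ(A,B) = min {k ≥ 1 : rank C_k(A,B) = n}`. -/
def ctrbIndex {n p : ℕ} (A : Matrix (Fin n) (Fin n) ℝ) (B : Matrix (Fin n) (Fin p) ℝ) : ℕ :=
  sInf {k : ℕ | 1 ≤ k ∧ ctrbRank A B k = n}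

/-- The singular value `σ_k(X)`, for `k ≥ 1`, with `σ_1(X) ≥ σ_2(X) ≥ …`. (Mathlib's sequence of
singular values starts at index `0`.) -/
def singularValue {m n : Type*} [Fintype m] [Fintype n] [DecidableEq m] [DecidableEq n]
    (k : ℕ) (X : Matrix m n ℝ) : ℝ :=
  (Matrix.toEuclideanLin X).singularValues (k - 1)

/-- The size `p_i = rank C_i - rank C_{i-1}` of the `i`-th block of the staircase form, `i ≥ 1`. -/
def blockSize {n p : ℕ} (A : Matrix (Fin n) (Fin n) ℝ) (B : Matrix (Fin n) (Fin p) ℝ) (i : ℕ) : ℕ :=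
  ctrbRank A B i - ctrbRank A B (i - 1)

/-- The coordinates that belong to the `i`-th block of the staircase form, `i ≥ 1`: counted from
zero, those in `[rank C_{i-1}, rank C_i)`. -/
abbrev Block {n p : ℕ} (A : Matrix (Fin n) (Fin n) ℝ) (B : Matrix (Fin n) (Fin p) ℝ) (i : ℕ) :
    Type :=
  {a : Fin n // ctrbRank A B (i - 1) ≤ (a : ℕ) ∧ (a : ℕ) < ctrbRank A B i}

/-- The orthogonal matrix `U` brings `(A,B)` to staircase (block Hessenberg) form: only the first
block row of `U'B` is nonzero, and in the `j`-th block column of `U'AU` all block rows after the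
`(j+1)`-st vanish. -/
structure IsStaircase {n p : ℕ} (A : Matrix (Fin n) (Fin n) ℝ) (B : Matrix (Fin n) (Fin p) ℝ)
    (U : Matrix (Fin n) (Fin n) ℝ) : Prop where
  transpose_mul : Uᵀ * U = 1
  mul_transpose : U * Uᵀ = 1
  input_zero : ∀ (a : Fin n) (q : Fin p), ctrbRank A B 1 ≤ (a : ℕ) → (Uᵀ * B) a q = 0
  state_zero : ∀ (j : ℕ) (a b : Fin n), (b : ℕ) < ctrbRank A B j → ctrbRank A B (j + 1) ≤ (a : ℕ) →
    (Uᵀ * A * U) a b = 0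

/-- The input block `B_1` of the staircase form given by `U`. -/
def inputBlock {n p : ℕ} (A : Matrix (Fin n) (Fin n) ℝ) (B : Matrix (Fin n) (Fin p) ℝ)
    (U : Matrix (Fin n) (Fin n) ℝ) : Matrix (Block A B 1) (Fin p) ℝ :=
  (Uᵀ * B).submatrix Subtype.val id

/-- The block `A_{i,j}` of the staircase form given by `U`. -/
def stateBlock {n p : ℕ} (A : Matrix (Fin n) (Fin n) ℝ) (B : Matrix (Fin n) (Fin p) ℝ)
    (U : Matrix (Fin n) (Fin n) ℝ) (i j : ℕ) : Matrix (Block A B i) (Block A B j) ℝ :=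
  (Uᵀ * A * U).submatrix Subtype.val Subtype.val

/-- `(A,B)` is `μ`-robustly coupled: `μ > 0`, and in a staircase form of the pair
`σ_p(B_1) ≥ μ` and `σ_{p_{i+1}}(A_{i+1,i}) ≥ μ` for `1 ≤ i ≤ κ - 1`. (A staircase form is unique up
to orthogonal changes of basis inside the blocks, so these singular values do not depend on `U`.) -/
def RobustlyCoupled {n p : ℕ} (μ : ℝ) (A : Matrix (Fin n) (Fin n) ℝ)
    (B : Matrix (Fin n) (Fin p) ℝ) : Prop :=
  0 < μ ∧ ∃ U : Matrix (Fin n) (Fin n) ℝ, IsStaircase A B U ∧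
    μ ≤ singularValue p (inputBlock A B U) ∧
    ∀ i : ℕ, 1 ≤ i → i < ctrbIndex A B →
      μ ≤ singularValue (blockSize A B (i + 1)) (stateBlock A B U (i + 1) i)

/-- `P` solves the discrete algebraic Riccati equation
`P = A'PA + Q - A'PB (B'PB + R)⁻¹ B'PA`. -/
def IsRiccatiSolution {n p : ℕ} (A : Matrix (Fin n) (Fin n) ℝ) (B : Matrix (Fin n) (Fin p) ℝ)
    (Q : Matrix (Fin n) (Fin n) ℝ) (R : Matrix (Fin p) (Fin p) ℝ)
    (P : Matrix (Fin n) (Fin n) ℝ) : Prop :=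
  P = Aᵀ * P * A + Q - Aᵀ * P * B * (Bᵀ * P * B + R)⁻¹ * Bᵀ * P * A

/-- The gain `K = -(B'PB + R)⁻¹ B'PA`. -/
def lqrGain {n p : ℕ} (A : Matrix (Fin n) (Fin n) ℝ) (B : Matrix (Fin n) (Fin p) ℝ)
    (R : Matrix (Fin p) (Fin p) ℝ) (P : Matrix (Fin n) (Fin n) ℝ) : Matrix (Fin p) (Fin n) ℝ :=
  -((Bᵀ * P * B + R)⁻¹ * Bᵀ * P * A)

/-- A real matrix, seen as a complex one. -/
def toComplex {n : ℕ} (X : Matrix (Fin n) (Fin n) ℝ) : Matrix (Fin n) (Fin n) ℂ :=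
  X.map (fun t : ℝ => (t : ℂ))

/-- The spectral radius `ρ(X)`: the largest modulus of a complex eigenvalue. -/
def specRadius {n : ℕ} (X : Matrix (Fin n) (Fin n) ℝ) : ℝ :=
  (spectralRadius ℂ (toComplex X)).toReal

/-- The `H_∞` norm `sup_{|z| = 1} ‖(zI - X)⁻¹‖₂` of the transfer matrix `(zI - X)⁻¹` of a matrix
`X` with `ρ(X) < 1`, as an extended nonnegative number. -/
def hInfNorm {n : ℕ} (X : Matrix (Fin n) (Fin n) ℝ) : ℝ≥0∞ :=
  ⨆ z : {z : ℂ // ‖z‖ = 1},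
    ENNReal.ofReal ‖((z : ℂ) • (1 : Matrix (Fin n) (Fin n) ℂ) - toComplex X)⁻¹‖

end LQR

end

/-! The form `V x = x'Px` is the optimal cost-to-go. By completion of squares
(`riccati_completion_of_squares`), `V x ≤ |x|² + |u|² + V (Ax + Bu)` for every `u`, so the cost of
any input that brings `x` to the origin in `κ` steps bounds `V x`. In staircase coordinates such an
input is built from the last block upwards: each block serves as a control for the next one, and
robust coupling inverts the coupling block at cost `1/μ`. This gives `P ≤ β I` with `β = κ³ (M^κ)²
((3M/μ)^κ)⁴` (`exists_tail_trajectory`, `cost_le_of_steering`, `riccati_solution_le`).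

With `u = Kx` the same identity shows that `V` drops by at least `|x|²` per step of the closed loop
`X`, so `I ≤ P ≤ β I` and `X` contracts the `P`-norm by the factor `1 - 1/(2β)`. Hence `1 - ρ(X) ≥
1/(2β)`, and the resolvent on the unit circle is at most `2β²` (`norm_le_of_lyapunov`).

The constant `3^κ` inside `β` is not polynomial in the given quantities. It is absorbed into powers
of `M^κ` and `(cM/μ)^κ`, or of `M^κ` and `(M/μ)^κ` if `M` or `M/μ` is at least `c`
(`three_mul_pow_le`). -/

namespace LQR

/-! ### Singular values: right inverses and upper bounds -/

/-- If the singular value of `L` whose index is the dimension of the codomain is at least `μ > 0`,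
then `L` has a right inverse of norm at most `μ⁻¹`. -/
theorem exists_preimage_of_le_singularValues {E F : Type*} [NormedAddCommGroup E]
    [InnerProductSpace ℝ E] [FiniteDimensional ℝ E] [NormedAddCommGroup F] [InnerProductSpace ℝ F]
    [FiniteDimensional ℝ F] (L : E →ₗ[ℝ] F) {μ : ℝ} (hμ : 0 < μ)
    (h : μ ≤ L.singularValues (Module.finrank ℝ F - 1)) (w : F) :
    ∃ v, L v = w ∧ μ * ‖v‖ ≤ ‖w‖ := by
  rcases Nat.eq_zero_or_pos (Module.finrank ℝ F) with h0 | hpos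
  · have := Module.finrank_zero_iff.1 h0
    exact ⟨0, Subsingleton.elim _ _, by simp⟩
  set m := Module.finrank ℝ F with hm
  -- Singular values past the dimension of `E` are zero by convention, so `μ > 0` forces `m ≤ dim
  -- E`.
  have hlt : m - 1 < Module.finrank ℝ E := by
    by_contra hc
    rw [L.singularValues_of_finrank_le (not_lt.1 hc)] at h
    exact absurd h (not_le.2 hμ)
  have hS := L.isSymmetric_adjoint_comp_self
  let ι : Fin m → Fin (Module.finrank ℝ E) := fun i => ⟨i, by omega⟩
  have hι : Function.Injective ι := fun i j hij => by
    apply Fin.ext; simpa [ι] using hij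
  have hon : Orthonormal ℝ (fun i : Fin m => hS.eigenvectorBasis rfl (ι i)) :=
    (hS.eigenvectorBasis rfl).orthonormal.comp ι hι
  let g : EuclideanSpace ℝ (Fin m) →ₗ[ℝ] E :=
    { toFun := fun c => ∑ i, c i • hS.eigenvectorBasis rfl (ι i)
      map_add' := fun c d => by simp [add_smul, Finset.sum_add_distrib]
      map_smul' := fun r c => by simp [mul_smul, Finset.smul_sum] }
  have hgn : ∀ c, ‖g c‖ ^ 2 = ∑ i, c i ^ 2 := fun c => by
    rw [← real_inner_self_eq_norm_sq]
    change inner ℝ (∑ i, c i • hS.eigenvectorBasis rfl (ι i))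
      (∑ i, c i • hS.eigenvectorBasis rfl (ι i)) = _
    rw [hon.inner_sum]
    simp [sq]
  have hσ : ∀ i : Fin m, μ ^ 2 ≤ hS.eigenvalues rfl (ι i) := fun i => by
    rw [← L.sq_singularValues_fin rfl (ι i)]
    have : μ ≤ L.singularValues (ι i) := h.trans (L.singularValues_antitone (by simp [ι]; omega))
    gcongr
  -- On the span of the top `m` eigenvectors of `L*L`, all eigenvalues are at least `μ²`, so `L` is
  -- bounded below by `μ`. A dimension count then makes it onto.
  have hLg : ∀ c, μ * ‖g c‖ ≤ ‖L (g c)‖ := fun c => by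
    refine abs_le_of_sq_le_sq' ?_ (norm_nonneg _) |>.2
    rw [mul_pow, hgn, ← real_inner_self_eq_norm_sq, ← LinearMap.adjoint_inner_left,
      ← LinearMap.comp_apply]
    have : (LinearMap.adjoint L ∘ₗ L) (g c)
        = ∑ i, (c i * hS.eigenvalues rfl (ι i)) • hS.eigenvectorBasis rfl (ι i) := by
      change (LinearMap.adjoint L ∘ₗ L) (∑ i, c i • hS.eigenvectorBasis rfl (ι i)) = _
      rw [map_sum]
      refine Finset.sum_congr rfl fun i _ => ?_
      rw [map_smul, hS.apply_eigenvectorBasis, smul_smul]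
      rfl
    rw [this]
    change _ ≤ inner ℝ _ (∑ i, c i • hS.eigenvectorBasis rfl (ι i))
    rw [hon.inner_sum, Finset.mul_sum]
    refine Finset.sum_le_sum fun i _ => ?_
    have := mul_le_mul_of_nonneg_right (hσ i) (sq_nonneg (c i))
    simp only [conj_trivial]
    linarith
  have hinj : Function.Injective (L ∘ₗ g) := by
    rw [← LinearMap.ker_eq_bot, LinearMap.ker_eq_bot']
    intro c hc
    have h1 := hLg c
    rw [← LinearMap.comp_apply, hc, norm_zero] at h1
    have h2 : ‖g c‖ = 0 := by
      have := norm_nonneg (g c)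
      nlinarith
    have h3 := hgn c
    rw [h2, zero_pow two_ne_zero, eq_comm,
      Finset.sum_eq_zero_iff_of_nonneg fun i _ => sq_nonneg _] at h3
    ext i
    simpa using h3 i (Finset.mem_univ i)
  have hsurj : Function.Surjective (L ∘ₗ g) :=
    (LinearMap.injective_iff_surjective_of_finrank_eq_finrank (by simp [hm])).1 hinj
  obtain ⟨c, rfl⟩ := hsurj w
  exact ⟨g c, rfl, hLg c⟩

/-- A singular value is the length of the image of a unit eigenvector of `L*L`. Applied to `B_1`,
this yields `μ ≤ M`. -/
theorem singularValues_le_of_bound {E F : Type*} [NormedAddCommGroup E]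
    [InnerProductSpace ℝ E] [FiniteDimensional ℝ E] [NormedAddCommGroup F] [InnerProductSpace ℝ F]
    [FiniteDimensional ℝ F] (L : E →ₗ[ℝ] F) {M : ℝ} (hM : 0 ≤ M) (h : ∀ x, ‖L x‖ ≤ M * ‖x‖)
    (i : ℕ) : L.singularValues i ≤ M := by
  rcases le_or_gt (Module.finrank ℝ E) i with hi | hi
  · rw [L.singularValues_of_finrank_le hi]; exact hM
  · have hS := L.isSymmetric_adjoint_comp_self
    set e := hS.eigenvectorBasis rfl ⟨i, hi⟩ with he
    have hn : ‖e‖ = 1 := (hS.eigenvectorBasis rfl).orthonormal.1 _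
    refine abs_le_of_sq_le_sq' ?_ hM |>.2
    have h1 : L.singularValues i ^ 2 = ‖L e‖ ^ 2 := by
      rw [L.sq_singularValues_of_lt rfl hi, ← real_inner_self_eq_norm_sq,
        ← LinearMap.adjoint_inner_left, ← LinearMap.comp_apply, he, hS.apply_eigenvectorBasis,
        ← he, real_inner_smul_left, real_inner_self_eq_norm_sq, hn]
      simp
    have h2 := h e
    rw [hn, mul_one] at h2
    rw [h1]
    gcongr

/-! ### Steering the state to the origin -/

/-- One step of the construction of a trajectory that reaches the origin: from the last blocks of
the trajectory, given by the projection `T (i + 1)`, to those given by `T i`. -/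
theorem exists_tail_trajectory {E : Type*} [NormedAddCommGroup E] [NormedSpace ℝ E]
    {A : E →ₗ[ℝ] E} {T : ℕ → E →ₗ[ℝ] E} {k : ℕ} {M μ : ℝ} (hM : 1 ≤ M) (hμ : 0 < μ) (hμM : μ ≤ M)
    (hA : ∀ x, ‖A x‖ ≤ M * ‖x‖) (hT : ∀ i x, ‖T i x‖ ≤ ‖x‖) (hTk : T (k + 1) = 0)
    (hidem : ∀ i x, T i (T i x) = T i x) (hdown : ∀ i x, T (i + 1) (T i x) = T (i + 1) x)
    (hup : ∀ i x, T i (T (i + 1) x) = T (i + 1) x)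
    (hess : ∀ i x, T (i + 1) (A (T i x)) = T (i + 1) (A x))
    (hsurj : ∀ i < k, ∀ w, T (i + 1) w = w → T (i + 2) w = 0 →
      ∃ v, T i v = v ∧ T (i + 1) v = 0 ∧ T (i + 1) (A v) = w ∧ μ * ‖v‖ ≤ ‖w‖)
    (x : E) (j i : ℕ) (hij : i + j = k) :
    ∃ z : ℕ → E, (∀ t, T i (z t) = z t) ∧ (∀ t ≤ i, z t = T i ((A ^ t) x)) ∧
      (∀ t, k < t → z t = 0) ∧ (∀ t, T (i + 1) (z (t + 1)) = T (i + 1) (A (z t))) ∧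
      ∀ t, ‖z t‖ ≤ (j + 1) * (3 * (M / μ)) ^ j * (M ^ k * ‖x‖) := by
  have hM0 : 0 ≤ M := zero_le_one.trans hM
  have hpow : ∀ t, ‖(A ^ t) x‖ ≤ M ^ t * ‖x‖ := fun t => by
    induction t with
    | zero => simp
    | succ t ih =>
      rw [pow_succ', Module.End.mul_apply]
      calc _ ≤ M * ‖(A ^ t) x‖ := hA _
        _ ≤ M * (M ^ t * ‖x‖) := by gcongr
        _ = _ := by ring
  have hfree : ∀ i t, t ≤ k → ‖T i ((A ^ t) x)‖ ≤ M ^ k * ‖x‖ := fun i t ht =>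
    ((hT _ _).trans (hpow t)).trans (by gcongr)
  have hN : 0 ≤ M ^ k * ‖x‖ := by positivity
  have ha : 1 ≤ M / μ := (one_le_div hμ).2 hμM
  -- `T i` keeps the blocks after the `i`-th. The dynamics are imposed on `z` only after block `i +
  -- 1`, so block `i + 1` of `z` acts as a free input. At `i = k` there is no constraint; at `i = 0`
  -- only the first block remains, and it is left to the true input.
  induction j generalizing i with
  | zero =>
    obtain rfl : i = k := by omega
    refine ⟨fun t => if t ≤ i then T i ((A ^ t) x) else 0, fun t => ?_, fun t ht => ?_,
      fun t ht => ?_, fun t => ?_, fun t => ?_⟩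
    · dsimp only; split_ifs <;> simp [hidem]
    · simp [ht]
    · simp [not_le.2 ht]
    · simp [hTk]
    · dsimp only
      split_ifs with h
      · simpa using hfree i t h
      · simpa using hN
  | succ j ih =>
    obtain ⟨z, z1, z2, z3, z4, z5⟩ := ih (i + 1) (by omega)
    -- By `z4` the defect in the dynamics lives in block `i + 2` alone, so a correction `v` in block
    -- `i + 1` removes it through the coupling block.
    have hw : ∀ t, ∃ v, T i v = v ∧ T (i + 1) v = 0 ∧
        T (i + 1) (A v) = z (t + 1) - T (i + 1) (A (z t)) ∧
        μ * ‖v‖ ≤ ‖z (t + 1) - T (i + 1) (A (z t))‖ := fun t => by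
      refine hsurj i (by omega) _ ?_ ?_
      · rw [map_sub, z1, hidem]
      · rw [map_sub, z4, hdown, sub_self]
    choose v v1 v2 v3 v4 using hw
    -- Up to time `i` the free motion is kept, which needs no correction and preserves the initial
    -- state.
    refine ⟨fun t => if t ≤ i then T i ((A ^ t) x) else z t + v t, fun t => ?_, fun t ht => ?_,
      fun t ht => ?_, fun t => ?_, fun t => ?_⟩
    · dsimp only
      split_ifs
      · rw [hidem]
      · rw [map_add, v1]
        nth_rw 1 [← z1]
        rw [hup, z1]
    · simp [ht]
    · have h1 : v t = 0 := by
        have := v4 t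
        rw [z3 t ht, z3 (t + 1) (by omega)] at this
        simp only [map_zero, sub_zero, norm_zero] at this
        have h0 := norm_nonneg (v t)
        have : ‖v t‖ = 0 := by nlinarith
        exact norm_eq_zero.1 this
      dsimp only
      rw [if_neg (by omega), z3 t ht, h1, add_zero]
    · have hT1 : ∀ t, T (i + 1) (if t ≤ i then T i ((A ^ t) x) else z t + v t) = z t := by
        intro t
        split_ifs with h
        · rw [hdown, z2 t (by omega)]
        · rw [map_add, z1, v2, add_zero]
      dsimp only
      rw [hT1]
      split_ifs with h
      · rw [hess, z2 (t + 1) (by omega), pow_succ', Module.End.mul_apply]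
      · rw [map_add, map_add, v3]
        abel
    · dsimp only
      set D := ((j : ℝ) + 1) * (3 * (M / μ)) ^ j * (M ^ k * ‖x‖) with hD
      have hD0 : 0 ≤ D := by positivity
      have h3 : (1 : ℝ) ≤ (3 * (M / μ)) ^ (j + 1) := one_le_pow₀ (by linarith)
      -- The free and the corrected cases are bounded by their sum; this is the source of the factor
      -- `j + 1`.
      have key : M ^ k * ‖x‖ + 3 * (M / μ) * D
          ≤ (((j + 1 : ℕ) : ℝ) + 1) * (3 * (M / μ)) ^ (j + 1) * (M ^ k * ‖x‖) := by
        rw [hD]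
        push_cast
        have := mul_le_mul_of_nonneg_right h3 hN
        rw [pow_succ] at this ⊢
        linarith
      split_ifs with h
      · refine (hfree i t (by omega)).trans (le_trans ?_ key)
        have : 0 ≤ 3 * (M / μ) * D := by positivity
        linarith
      · refine le_trans ?_ key
        have e1 : ‖z (t + 1) - T (i + 1) (A (z t))‖ ≤ D + M * D := by
          refine (norm_sub_le _ _).trans (add_le_add (z5 _) ?_)
          exact (hT _ _).trans ((hA _).trans (by gcongr; exact z5 _))
        -- Since `M ≥ 1`, `D + M D ≤ 2 M D`. Adding `‖z t‖ ≤ D ≤ (M / μ) D` gives the growth factor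
        -- `3 M / μ`.
        have e2 : ‖v t‖ ≤ 2 * (M / μ) * D := by
          have h5 : μ * ‖v t‖ ≤ μ * (2 * (M / μ) * D) := by
            refine ((v4 t).trans e1).trans ?_
            have : μ * (2 * (M / μ) * D) = 2 * M * D := by field_simp
            rw [this]
            nlinarith
          exact le_of_mul_le_mul_left h5 hμ
        have e3 : D ≤ M / μ * D := le_mul_of_one_le_left hD0 ha
        have := norm_add_le (z t) (v t)
        have := z5 t
        linarith

/-- A quadratic cost-to-go is bounded by the cost of steering the state to the origin. -/
theorem cost_le_of_steering {E F : Type*} [NormedAddCommGroup E] [NormedSpace ℝ E]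
    [NormedAddCommGroup F] [NormedSpace ℝ F] {A : E →ₗ[ℝ] E} {B : F →ₗ[ℝ] E}
    {T : ℕ → E →ₗ[ℝ] E} {k : ℕ} {M μ : ℝ} (hM : 1 ≤ M) (hμ : 0 < μ) (hμM : μ ≤ M)
    (hA : ∀ x, ‖A x‖ ≤ M * ‖x‖) (hT : ∀ i x, ‖T i x‖ ≤ ‖x‖) (hT0 : T 0 = LinearMap.id)
    (hTk : T (k + 1) = 0)
    (hidem : ∀ i x, T i (T i x) = T i x) (hdown : ∀ i x, T (i + 1) (T i x) = T (i + 1) x)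
    (hup : ∀ i x, T i (T (i + 1) x) = T (i + 1) x)
    (hess : ∀ i x, T (i + 1) (A (T i x)) = T (i + 1) (A x))
    (hsurj : ∀ i < k, ∀ w, T (i + 1) w = w → T (i + 2) w = 0 →
      ∃ v, T i v = v ∧ T (i + 1) v = 0 ∧ T (i + 1) (A v) = w ∧ μ * ‖v‖ ≤ ‖w‖)
    (hB : ∀ w, T 1 w = 0 → ∃ u, B u = w ∧ μ * ‖u‖ ≤ ‖w‖)
    {V : E → ℝ} (hV0 : V 0 = 0) (hV : ∀ x u, V x ≤ ‖x‖ ^ 2 + ‖u‖ ^ 2 + V (A x + B u)) (x : E) :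
    V x ≤ ((k + 1 : ℕ) : ℝ) ^ 3 * (M ^ (k + 1)) ^ 2 * ((3 * (M / μ)) ^ (k + 1)) ^ 4 * ‖x‖ ^ 2 := by
  obtain ⟨z, -, z2, z3, z4, z5⟩ := exists_tail_trajectory hM hμ hμM hA hT hTk hidem hdown hup hess
    hsurj x k 0 (by omega)
  have ha : 1 ≤ M / μ := (one_le_div hμ).2 hμM
  set D := ((k : ℝ) + 1) * (3 * (M / μ)) ^ k * (M ^ k * ‖x‖) with hD
  have hD0 : 0 ≤ D := by positivity
  -- The remaining defect lies in the first block, where `B` can produce it.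
  have hu : ∀ t, ∃ u, B u = z (t + 1) - A (z t) ∧ μ * ‖u‖ ≤ ‖z (t + 1) - A (z t)‖ := fun t =>
    hB _ (by rw [map_sub, z4, sub_self])
  choose u u1 u2 using hu
  have hun : ∀ t, ‖u t‖ ≤ 2 * (M / μ) * D := fun t => by
    have e1 : ‖z (t + 1) - A (z t)‖ ≤ D + M * D :=
      (norm_sub_le _ _).trans (add_le_add (z5 _) ((hA _).trans (by gcongr; exact z5 _)))
    have h5 : μ * ‖u t‖ ≤ μ * (2 * (M / μ) * D) := by
      refine ((u2 t).trans e1).trans ?_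
      have : μ * (2 * (M / μ) * D) = 2 * M * D := by field_simp
      rw [this]
      nlinarith
    exact le_of_mul_le_mul_left h5 hμ
  set C := D ^ 2 + (2 * (M / μ) * D) ^ 2 with hC
  have hstep : ∀ t, V (z t) ≤ C + V (z (t + 1)) := fun t => by
    have h1 := hV (z t) (u t)
    rw [u1, add_sub_cancel] at h1
    have h2 : ‖z t‖ ^ 2 ≤ D ^ 2 := by gcongr; exact z5 t
    have h3 : ‖u t‖ ^ 2 ≤ (2 * (M / μ) * D) ^ 2 := by gcongr; exact hun t
    linarith
  have hsum : ∀ t : ℕ, V (z 0) ≤ t * C + V (z t) := fun t => by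
    induction t with
    | zero => simp
    | succ t ih =>
      have := hstep t
      push_cast
      linarith
  have hz0 : z 0 = x := by rw [z2 0 le_rfl, hT0]; simp
  have h1 := hsum (k + 1)
  rw [hz0, z3 (k + 1) (by omega), hV0, add_zero] at h1
  refine h1.trans ?_
  set a := M / μ
  have hCle : C ≤ (3 * a) ^ 2 * D ^ 2 := by
    rw [hC]
    have : D ^ 2 ≤ a ^ 2 * D ^ 2 := le_mul_of_one_le_left (by positivity) (one_le_pow₀ ha)
    have h' : 0 ≤ a ^ 2 * D ^ 2 := by positivity
    linarith [show (2 * a * D) ^ 2 = 4 * (a ^ 2 * D ^ 2) by ring,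
      show (3 * a) ^ 2 * D ^ 2 = 9 * (a ^ 2 * D ^ 2) by ring]
  -- Exponents are rounded up to multiples of `k + 1 = κ`, so that the bound is a monomial in the
  -- `κ`-th powers.
  have hM1 : M ^ k ≤ M ^ (k + 1) := pow_le_pow_right₀ hM (by omega)
  have h3a : (1 : ℝ) ≤ 3 * a := by linarith
  have h32 : (3 * a) ^ 2 * ((3 * a) ^ k) ^ 2 ≤ ((3 * a) ^ (k + 1)) ^ 4 := by
    rw [← mul_pow, ← pow_succ']
    exact pow_le_pow_right₀ (one_le_pow₀ h3a) (by norm_num)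
  calc ((k + 1 : ℕ) : ℝ) * C ≤ ((k + 1 : ℕ) : ℝ) * ((3 * a) ^ 2 * D ^ 2) := by gcongr
    _ = ((k + 1 : ℕ) : ℝ) ^ 3 * (M ^ k) ^ 2 * ((3 * a) ^ 2 * ((3 * a) ^ k) ^ 2) * ‖x‖ ^ 2 := by
      rw [hD]; push_cast; ring
    _ ≤ _ := by gcongr

/-! ### The Riccati equation as an optimality inequality -/

/-- Completion of squares: the cost of one step followed by the optimal cost-to-go exceeds the
optimal cost-to-go by a quadratic form in `u - K x`. -/
theorem riccati_completion_of_squares {n p : ℕ} {A : Matrix (Fin n) (Fin n) ℝ}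
    {B : Matrix (Fin n) (Fin p) ℝ} {P : Matrix (Fin n) (Fin n) ℝ} (hP : P.PosDef)
    (hR : IsRiccatiSolution A B 1 1 P) (x : Fin n → ℝ) (u : Fin p → ℝ) :
    x ⬝ᵥ P *ᵥ x + (u - lqrGain A B 1 P *ᵥ x) ⬝ᵥ (Bᵀ * P * B + 1) *ᵥ (u - lqrGain A B 1 P *ᵥ x) =
      x ⬝ᵥ x + u ⬝ᵥ u + (A *ᵥ x + B *ᵥ u) ⬝ᵥ P *ᵥ (A *ᵥ x + B *ᵥ u) := by
  have hPt : Pᵀ = P := by simpa using hP.isHermitian.eq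
  have hG : (Bᵀ * P * B + 1).PosDef := by
    have := hP.posSemidef.conjTranspose_mul_mul_same B
    rw [Matrix.conjTranspose_eq_transpose_of_trivial] at this
    exact Matrix.PosDef.posSemidef_add this Matrix.PosDef.one
  set G := Bᵀ * P * B + 1 with hGd
  have hGt : Gᵀ = G := by simpa using hG.isHermitian.eq
  have hGu : G * G⁻¹ = 1 := Matrix.mul_nonsing_inv _ ((Matrix.isUnit_iff_isUnit_det _).1 hG.isUnit)
  set w := Bᵀ *ᵥ P *ᵥ A *ᵥ x with hw
  have hK : lqrGain A B 1 P *ᵥ x = -(G⁻¹ *ᵥ w) := by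
    simp only [lqrGain, Matrix.neg_mulVec, hw, Matrix.mulVec_mulVec, Matrix.mul_assoc, hGd]
  have hGw : G *ᵥ G⁻¹ *ᵥ w = w := by rw [Matrix.mulVec_mulVec, hGu, Matrix.one_mulVec]
  have hsymG : ∀ a b : Fin p → ℝ, a ⬝ᵥ G *ᵥ b = (G *ᵥ a) ⬝ᵥ b := fun a b => by
    rw [Matrix.dotProduct_mulVec, ← Matrix.mulVec_transpose, hGt]
  have hsymP : ∀ a b : Fin n → ℝ, a ⬝ᵥ P *ᵥ b = (P *ᵥ a) ⬝ᵥ b := fun a b => by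
    rw [Matrix.dotProduct_mulVec, ← Matrix.mulVec_transpose, hPt]
  have hBt : ∀ (a : Fin p → ℝ) (b : Fin n → ℝ), (B *ᵥ a) ⬝ᵥ b = a ⬝ᵥ Bᵀ *ᵥ b := fun a b => by
    rw [Matrix.dotProduct_mulVec, ← Matrix.mulVec_transpose, Matrix.transpose_transpose]
  have hAt : ∀ (a b : Fin n → ℝ), (A *ᵥ a) ⬝ᵥ b = a ⬝ᵥ Aᵀ *ᵥ b := fun a b => by
    rw [Matrix.dotProduct_mulVec, ← Matrix.mulVec_transpose, Matrix.transpose_transpose]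
  -- This is the only place where the Riccati equation enters; the rest expands the form of `G` at
  -- `u + G⁻¹ w`.
  have hxx : x ⬝ᵥ P *ᵥ x = (A *ᵥ x) ⬝ᵥ P *ᵥ A *ᵥ x + x ⬝ᵥ x - w ⬝ᵥ G⁻¹ *ᵥ w := by
    have h1 : P *ᵥ x = Aᵀ *ᵥ P *ᵥ A *ᵥ x + x - Aᵀ *ᵥ P *ᵥ B *ᵥ G⁻¹ *ᵥ w := by
      conv_lhs => rw [show P = _ from hR]
      simp only [Matrix.sub_mulVec, Matrix.add_mulVec, Matrix.one_mulVec, hw, hGd,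
        Matrix.mulVec_mulVec, Matrix.mul_assoc]
    have h2 : x ⬝ᵥ Aᵀ *ᵥ P *ᵥ B *ᵥ G⁻¹ *ᵥ w = w ⬝ᵥ G⁻¹ *ᵥ w := by
      rw [← hAt, hsymP, dotProduct_comm, hBt, dotProduct_comm]
    rw [h1, dotProduct_sub, dotProduct_add, ← hAt, h2]
  have huu : u ⬝ᵥ G *ᵥ u = (B *ᵥ u) ⬝ᵥ P *ᵥ B *ᵥ u + u ⬝ᵥ u := by
    rw [hGd, Matrix.add_mulVec, dotProduct_add, Matrix.one_mulVec, hBt]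
    simp only [Matrix.mulVec_mulVec, Matrix.mul_assoc]
  have hcross : (B *ᵥ u) ⬝ᵥ P *ᵥ A *ᵥ x = u ⬝ᵥ w := by rw [hBt]
  have hcross' : (A *ᵥ x) ⬝ᵥ P *ᵥ B *ᵥ u = u ⬝ᵥ w := by
    rw [hsymP, dotProduct_comm, hcross]
  rw [hK, sub_neg_eq_add, Matrix.mulVec_add, hGw]
  simp only [Matrix.mulVec_add, dotProduct_add, add_dotProduct]
  rw [hcross, hcross', huu, hxx, hsymG (G⁻¹ *ᵥ w) u, hGw, dotProduct_comm (G⁻¹ *ᵥ w) w,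
    dotProduct_comm w u]
  ring

/-! ### Controllability ranks, coordinate projections and staircase blocks -/

theorem ctrbRank_mono {n p : ℕ} (A : Matrix (Fin n) (Fin n) ℝ) (B : Matrix (Fin n) (Fin p) ℝ)
    (k : ℕ) : ctrbRank A B k ≤ ctrbRank A B (k + 1) := by
  have : ctrbMatrix A B k = ctrbMatrix A B (k + 1) *
      (1 : Matrix (Fin (k + 1) × Fin p) (Fin (k + 1) × Fin p) ℝ).submatrix id
        (Prod.map Fin.castSucc id) := by
    ext a q
    simp [ctrbMatrix, Matrix.mul_apply, Matrix.one_apply]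
  rw [ctrbRank, this]
  exact Matrix.rank_mul_le_left _ _

theorem ctrbRank_zero {n p : ℕ} (A : Matrix (Fin n) (Fin n) ℝ) (B : Matrix (Fin n) (Fin p) ℝ) :
    ctrbRank A B 0 = 0 := by
  have := (ctrbMatrix A B 0).rank_le_card_width
  simpa [ctrbRank] using this

theorem ctrbRank_one_le {n p : ℕ} (A : Matrix (Fin n) (Fin n) ℝ) (B : Matrix (Fin n) (Fin p) ℝ) :
    ctrbRank A B 1 ≤ p := by
  have := (ctrbMatrix A B 1).rank_le_card_width
  simpa [ctrbRank] using this

theorem Controllable.ctrbIndex_spec {n p : ℕ} {A : Matrix (Fin n) (Fin n) ℝ}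
    {B : Matrix (Fin n) (Fin p) ℝ} (h : Controllable A B) :
    1 ≤ ctrbIndex A B ∧ ctrbRank A B (ctrbIndex A B) = n := by
  refine Nat.sInf_mem (s := {k : ℕ | 1 ≤ k ∧ ctrbRank A B k = n}) ?_
  obtain ⟨k, -, hk⟩ := h
  rcases Nat.eq_zero_or_pos k with rfl | hpos
  -- If `k = 0` attains rank `n`, then `n = 0`, and the index is `1` because it is required to be
  -- positive.
  · refine ⟨1, le_rfl, ?_⟩
    have h1 := ctrbRank_mono A B 0
    have h2 := (ctrbMatrix A B 1).rank_le_card_height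
    rw [Fintype.card_fin] at h2
    rw [hk] at h1
    exact le_antisymm h2 h1
  · exact ⟨k, hpos, hk⟩

/-- The projection onto the coordinates from `r` on. -/
def tailProj {n : ℕ} (r : ℕ) : EuclideanSpace ℝ (Fin n) →ₗ[ℝ] EuclideanSpace ℝ (Fin n) where
  toFun y := WithLp.toLp 2 fun a => if r ≤ (a : ℕ) then y a else 0
  map_add' y z := by ext a; simp only [PiLp.add_apply]; split_ifs <;> simp
  map_smul' c y := by ext a; simp

@[simp]
theorem tailProj_apply {n : ℕ} (r : ℕ) (y : EuclideanSpace ℝ (Fin n)) (a : Fin n) :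
    tailProj r y a = if r ≤ (a : ℕ) then y a else 0 := rfl

theorem norm_tailProj_le {n : ℕ} (r : ℕ) (y : EuclideanSpace ℝ (Fin n)) :
    ‖tailProj r y‖ ≤ ‖y‖ := by
  rw [EuclideanSpace.norm_eq, EuclideanSpace.norm_eq]
  gcongr with a
  rw [tailProj_apply]
  split_ifs <;> simp

theorem tailProj_tailProj {n : ℕ} (r s : ℕ) (y : EuclideanSpace ℝ (Fin n)) :
    tailProj r (tailProj s y) = tailProj (max r s) y := by
  ext a
  simp only [tailProj_apply]
  grind

theorem dotProduct_self_eq_norm_sq {ι : Type*} [Fintype ι] (x : ι → ℝ) :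
    x ⬝ᵥ x = ‖WithLp.toLp 2 x‖ ^ 2 := by
  rw [EuclideanSpace.real_norm_sq_eq]
  simp [dotProduct, sq]

theorem norm_mulVec_of_transpose_mul_eq_one {n : ℕ} {U : Matrix (Fin n) (Fin n) ℝ}
    (hU : Uᵀ * U = 1) (x : Fin n → ℝ) : ‖WithLp.toLp 2 (U *ᵥ x)‖ = ‖WithLp.toLp 2 x‖ := by
  rw [← sq_eq_sq₀ (norm_nonneg _) (norm_nonneg _), ← dotProduct_self_eq_norm_sq,
    ← dotProduct_self_eq_norm_sq, Matrix.dotProduct_mulVec, ← Matrix.mulVec_transpose,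
    Matrix.mulVec_mulVec, hU, Matrix.one_mulVec]

theorem norm_extend_subtype {n : ℕ} {s : Fin n → Prop} [DecidablePred s] (v : {a // s a} → ℝ) :
    ‖WithLp.toLp 2 fun a => if h : s a then v ⟨a, h⟩ else 0‖ = ‖WithLp.toLp 2 v‖ := by
  rw [← sq_eq_sq₀ (norm_nonneg _) (norm_nonneg _), EuclideanSpace.real_norm_sq_eq,
    EuclideanSpace.real_norm_sq_eq, ← Fintype.sum_subtype_add_sum_subtype s]
  have h1 : ∀ a : {a // s a},
      (WithLp.toLp 2 fun a => if h : s a then v ⟨a, h⟩ else 0 : EuclideanSpace ℝ (Fin n)) a = v a :=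
    fun a => by simp [a.2]
  have h2 : ∀ a : {a // ¬ s a},
      (WithLp.toLp 2 fun a => if h : s a then v ⟨a, h⟩ else 0 : EuclideanSpace ℝ (Fin n)) a = 0 :=
    fun a => by simp [a.2]
  have h3 := Finset.sum_eq_zero (s := Finset.univ) fun (a : {a // ¬ s a}) _ =>
    (by rw [h2 a, zero_pow two_ne_zero] :
      (WithLp.toLp 2 fun a => if h : s a then v ⟨a, h⟩ else 0 : EuclideanSpace ℝ (Fin n)) a ^ 2 = 0)
  rw [h3, add_zero]
  exact Finset.sum_congr rfl fun a _ => by rw [h1 a]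

theorem norm_restrict_subtype_le {n : ℕ} {s : Fin n → Prop} [DecidablePred s] (v : Fin n → ℝ) :
    ‖WithLp.toLp 2 fun a : {a // s a} => v a‖ ≤ ‖WithLp.toLp 2 v‖ := by
  rw [← sq_le_sq₀ (norm_nonneg _) (norm_nonneg _), EuclideanSpace.real_norm_sq_eq,
    EuclideanSpace.real_norm_sq_eq, ← Fintype.sum_subtype_add_sum_subtype s]
  exact le_add_of_nonneg_right (Finset.sum_nonneg fun _ _ => sq_nonneg _)

theorem ctrbRank_le {n p : ℕ} (A : Matrix (Fin n) (Fin n) ℝ) (B : Matrix (Fin n) (Fin p) ℝ)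
    (k : ℕ) : ctrbRank A B k ≤ n := by
  have := (ctrbMatrix A B k).rank_le_card_height
  rwa [Fintype.card_fin] at this

theorem card_block {n p : ℕ} (A : Matrix (Fin n) (Fin n) ℝ) (B : Matrix (Fin n) (Fin p) ℝ)
    (i : ℕ) : Fintype.card (Block A B i) = blockSize A B i := by
  have hle := ctrbRank_le A B i
  have : Fintype.card (Block A B i)
      = (Finset.Ico (ctrbRank A B (i - 1)) (ctrbRank A B i)).card := by
    refine Finset.card_bij (fun a _ => (a.1 : ℕ)) (fun a _ => ?_) (fun a _ b _ h => ?_)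
      fun b hb => ?_
    · simpa using a.2
    · exact Subtype.ext (Fin.ext h)
    · rw [Finset.mem_Ico] at hb
      exact ⟨⟨⟨b, hb.2.trans_le hle⟩, hb⟩, Finset.mem_univ _, rfl⟩
  rw [this, Nat.card_Ico, blockSize]

theorem exists_preimage_of_le_singularValue {m n : Type*} [Fintype m] [Fintype n] [DecidableEq m]
    [DecidableEq n] {X : Matrix m n ℝ} {μ : ℝ} (hμ : 0 < μ) {k : ℕ} (hk : Fintype.card m ≤ k)
    (h : μ ≤ singularValue k X) (w : m → ℝ) :
    ∃ v, X *ᵥ v = w ∧ μ * ‖WithLp.toLp 2 v‖ ≤ ‖WithLp.toLp 2 w‖ := by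
  obtain ⟨v, hv, hn⟩ := exists_preimage_of_le_singularValues (Matrix.toEuclideanLin X) hμ
    (h.trans (LinearMap.singularValues_antitone _ (by
      rw [finrank_euclideanSpace]; omega))) (WithLp.toLp 2 w)
  exact ⟨v.ofLp, congrArg WithLp.ofLp hv, hn⟩

/-- The vector `w` lives in block `i + 2`. A preimage under the coupling block, extended by zero,
works: the projection discards the rows above that block, and the staircase zeros kill those below.
-/
theorem exists_state_preimage {n p : ℕ} {A : Matrix (Fin n) (Fin n) ℝ}
    {B : Matrix (Fin n) (Fin p) ℝ} {U : Matrix (Fin n) (Fin n) ℝ} {μ : ℝ} (hU : IsStaircase A B U)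
    (hμ : 0 < μ) {i : ℕ}
    (h : μ ≤ singularValue (blockSize A B (i + 2)) (stateBlock A B U (i + 2) (i + 1)))
    {w : EuclideanSpace ℝ (Fin n)} (hw1 : tailProj (ctrbRank A B (i + 1)) w = w)
    (hw2 : tailProj (ctrbRank A B (i + 2)) w = 0) :
    ∃ v, tailProj (ctrbRank A B i) v = v ∧ tailProj (ctrbRank A B (i + 1)) v = 0 ∧
      tailProj (ctrbRank A B (i + 1)) (Matrix.toEuclideanLin (Uᵀ * A * U) v) = w ∧
      μ * ‖v‖ ≤ ‖w‖ := by
  set r := ctrbRank A B with hrd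
  obtain ⟨v, hv, hvn⟩ := exists_preimage_of_le_singularValue hμ (card_block A B (i + 2)).le
    h (fun a => w a.1)
  have hsupp : ∀ a : Fin n, ¬ (r (i + 1) ≤ (a : ℕ) ∧ (a : ℕ) < r (i + 2)) → w a = 0 := by
    intro a ha
    by_cases h1 : r (i + 1) ≤ (a : ℕ)
    · have := congrArg (fun y : EuclideanSpace ℝ (Fin n) => y a) hw2
      simpa [not_lt.1 (fun h => ha ⟨h1, h⟩)] using this
    · have := congrArg (fun y : EuclideanSpace ℝ (Fin n) => y a) hw1
      simpa [h1] using this.symm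
  let e : EuclideanSpace ℝ (Fin n) := WithLp.toLp 2 fun b : Fin n =>
    if h : r (i + 1 - 1) ≤ (b : ℕ) ∧ (b : ℕ) < r (i + 1) then v ⟨b, h⟩ else 0
  have hmul : ∀ a, ((Uᵀ * A * U) *ᵥ e.ofLp) a = ∑ b : Block A B (i + 1), (Uᵀ * A * U) a b * v b := by
    intro a
    rw [Matrix.mulVec, dotProduct, ← Fintype.sum_subtype_add_sum_subtype
      (fun b : Fin n => r (i + 1 - 1) ≤ (b : ℕ) ∧ (b : ℕ) < r (i + 1))]
    have h1 : ∀ b : Block A B (i + 1), e.ofLp b.1 = v b := fun b => by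
      simp only [e]; rw [dif_pos b.2]
    have h2 : ∀ b : {b : Fin n // ¬ (r (i + 1 - 1) ≤ (b : ℕ) ∧ (b : ℕ) < r (i + 1))},
        e.ofLp b.1 = 0 := fun b => by
      simp only [e]; rw [dif_neg b.2]
    simp only [h2, mul_zero, Finset.sum_const_zero, add_zero]
    exact Finset.sum_congr rfl fun b _ => by rw [h1]
  refine ⟨e, ?_, ?_, ?_, ?_⟩
  · ext a
    simp only [tailProj_apply, e, add_tsub_cancel_right]
    grind
  · ext a
    simp only [tailProj_apply, e, add_tsub_cancel_right, PiLp.zero_apply]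
    grind
  · ext a
    simp only [tailProj_apply, Matrix.ofLp_toLpLin, Matrix.toLin'_apply]
    by_cases h1 : r (i + 1) ≤ (a : ℕ)
    · rw [if_pos h1, hmul]
      by_cases h2 : (a : ℕ) < r (i + 2)
      · exact congrFun hv ⟨a, h1, h2⟩
      · rw [hsupp a fun h => h2 h.2]
        refine Finset.sum_eq_zero fun b _ => ?_
        rw [hU.state_zero (i + 1) a b b.2.2 (not_lt.1 h2), zero_mul]
    · rw [if_neg h1, hsupp a fun h => h1 h.1]
  · rw [norm_extend_subtype]
    exact hvn.trans (norm_restrict_subtype_le w.ofLp)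

/-- `B_1` has at most `p` rows, so a bound on `σ_p` also bounds the singular value indexed by its
number of rows. All rows of `U'B` below `B_1` vanish. -/
theorem exists_input_preimage {n p : ℕ} {A : Matrix (Fin n) (Fin n) ℝ}
    {B : Matrix (Fin n) (Fin p) ℝ} {U : Matrix (Fin n) (Fin n) ℝ} {μ : ℝ} (hU : IsStaircase A B U)
    (hμ : 0 < μ) (h : μ ≤ singularValue p (inputBlock A B U))
    {w : EuclideanSpace ℝ (Fin n)} (hw : tailProj (ctrbRank A B 1) w = 0) :
    ∃ u, Matrix.toEuclideanLin (Uᵀ * B) u = w ∧ μ * ‖u‖ ≤ ‖w‖ := by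
  have hcard : Fintype.card (Block A B 1) ≤ p := by
    rw [card_block, blockSize]
    exact (Nat.sub_le _ _).trans (ctrbRank_one_le A B)
  obtain ⟨u, hu, hun⟩ := exists_preimage_of_le_singularValue hμ hcard h (fun a => w a.1)
  refine ⟨WithLp.toLp 2 u, ?_, hun.trans (norm_restrict_subtype_le w.ofLp)⟩
  ext a
  simp only [Matrix.ofLp_toLpLin, Matrix.toLin'_apply]
  by_cases h1 : ctrbRank A B 1 ≤ (a : ℕ)
  · have := congrArg (fun y : EuclideanSpace ℝ (Fin n) => y a) hw
    have hwa : w a = 0 := by simpa [h1] using this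
    rw [hwa, Matrix.mulVec, dotProduct]
    exact Finset.sum_eq_zero fun q _ => by rw [hU.input_zero a q h1, zero_mul]
  · exact congrFun hu ⟨a, by simp [ctrbRank_zero], not_le.1 h1⟩

/-! ### The bound on the Riccati solution -/

/-- The optimal cost of a robustly coupled pair is bounded in terms of `κ`, `M ^ κ` and
`(M / μ) ^ κ`. -/
theorem riccati_solution_le {n p : ℕ} {A : Matrix (Fin n) (Fin n) ℝ}
    {B : Matrix (Fin n) (Fin p) ℝ} {P : Matrix (Fin n) (Fin n) ℝ} {M μ : ℝ} (hM : 1 ≤ M)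
    (hA : ‖A‖ ≤ M) (hB : ‖B‖ ≤ M) (hc : Controllable A B) (hr : RobustlyCoupled μ A B)
    (hP : P.PosDef) (hR : IsRiccatiSolution A B 1 1 P) :
    μ ≤ M ∧ ∀ x : Fin n → ℝ, x ⬝ᵥ P *ᵥ x ≤ (ctrbIndex A B : ℝ) ^ 3 * (M ^ ctrbIndex A B) ^ 2 *
      ((3 * (M / μ)) ^ ctrbIndex A B) ^ 4 * (x ⬝ᵥ x) := by
  obtain ⟨hκ, hκn⟩ := hc.ctrbIndex_spec
  obtain ⟨hμ, U, hU, hin, hst⟩ := hr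
  obtain ⟨k, hk⟩ : ∃ k, ctrbIndex A B = k + 1 := ⟨ctrbIndex A B - 1, by omega⟩
  rw [hk] at hκn hst ⊢
  have hM0 : 0 ≤ M := zero_le_one.trans hM
  have hUt : (Uᵀ)ᵀ * Uᵀ = 1 := by rw [Matrix.transpose_transpose, hU.mul_transpose]
  have hAn : ∀ x : Fin n → ℝ, ‖WithLp.toLp 2 ((Uᵀ * A * U) *ᵥ x)‖ ≤ M * ‖WithLp.toLp 2 x‖ := by
    intro x
    rw [← Matrix.mulVec_mulVec, ← Matrix.mulVec_mulVec, norm_mulVec_of_transpose_mul_eq_one hUt,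
      ← norm_mulVec_of_transpose_mul_eq_one hU.transpose_mul x]
    exact (A.l2_opNorm_mulVec (WithLp.toLp 2 (U *ᵥ x))).trans (by gcongr)
  have hBn : ∀ u : Fin p → ℝ, ‖WithLp.toLp 2 ((Uᵀ * B) *ᵥ u)‖ ≤ M * ‖WithLp.toLp 2 u‖ := by
    intro u
    rw [← Matrix.mulVec_mulVec, norm_mulVec_of_transpose_mul_eq_one hUt]
    exact (B.l2_opNorm_mulVec (WithLp.toLp 2 u)).trans (by gcongr)
  have hB1 : ∀ u, ‖Matrix.toEuclideanLin (inputBlock A B U) u‖ ≤ M * ‖u‖ := fun u =>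
    (norm_restrict_subtype_le ((Uᵀ * B) *ᵥ u.ofLp)).trans (hBn u.ofLp)
  have hμM : μ ≤ M := hin.trans (singularValues_le_of_bound _ hM0 hB1 _)
  refine ⟨hμM, fun x => ?_⟩
  set r := ctrbRank A B with hrd
  have hmono : Monotone r := monotone_nat_of_le_succ (ctrbRank_mono A B)
  have hVU : ∀ y : Fin n → ℝ, U *ᵥ Uᵀ *ᵥ y = y := fun y => by
    rw [Matrix.mulVec_mulVec, hU.mul_transpose, Matrix.one_mulVec]
  let T : ℕ → EuclideanSpace ℝ (Fin n) →ₗ[ℝ] EuclideanSpace ℝ (Fin n) := fun i => tailProj (r i)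
  let A' := Matrix.toEuclideanLin (Uᵀ * A * U)
  let B' := Matrix.toEuclideanLin (Uᵀ * B)
  -- The cost-to-go in staircase coordinates; as `U` is orthogonal, the stage cost is unchanged.
  let V : EuclideanSpace ℝ (Fin n) → ℝ := fun y => (U *ᵥ y.ofLp) ⬝ᵥ P *ᵥ (U *ᵥ y.ofLp)
  have hA' : ∀ x, ‖A' x‖ ≤ M * ‖x‖ := fun y => hAn y.ofLp
  have hT : ∀ i x, ‖T i x‖ ≤ ‖x‖ := fun i => norm_tailProj_le _
  have hT0 : T 0 = LinearMap.id := by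
    ext y a
    simp [T, hrd, ctrbRank_zero]
  have hTk : T (k + 1) = 0 := by
    ext y a
    simp [T, hκn]
  have hidem : ∀ i x, T i (T i x) = T i x := by
    intro i y
    simp only [T]
    rw [tailProj_tailProj, max_self]
  have hdown : ∀ i x, T (i + 1) (T i x) = T (i + 1) x := by
    intro i y
    simp only [T]
    rw [tailProj_tailProj, max_eq_left (hmono (Nat.le_succ i))]
  have hup : ∀ i x, T i (T (i + 1) x) = T (i + 1) x := by
    intro i y
    simp only [T]
    rw [tailProj_tailProj, max_eq_right (hmono (Nat.le_succ i))]
  have hess : ∀ i x, T (i + 1) (A' (T i x)) = T (i + 1) (A' x) := by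
    intro i y
    ext a
    simp only [T, A', tailProj_apply, Matrix.ofLp_toLpLin, Matrix.toLin'_apply]
    split_ifs with h
    · rw [Matrix.mulVec, Matrix.mulVec, dotProduct, dotProduct]
      refine Finset.sum_congr rfl fun b _ => ?_
      rw [tailProj_apply]
      split_ifs with hb
      · rfl
      · rw [hU.state_zero i a b (not_le.1 hb) h]; simp
    · rfl
  have hsurj : ∀ i < k, ∀ w, T (i + 1) w = w → T (i + 2) w = 0 →
      ∃ v, T i v = v ∧ T (i + 1) v = 0 ∧ T (i + 1) (A' v) = w ∧ μ * ‖v‖ ≤ ‖w‖ := by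
    intro i hi w hw1 hw2
    exact exists_state_preimage hU hμ (hst (i + 1) (by omega) (by omega)) hw1 hw2
  have hsurjB : ∀ w, T 1 w = 0 → ∃ u, B' u = w ∧ μ * ‖u‖ ≤ ‖w‖ := by
    intro w hw
    exact exists_input_preimage hU hμ hin hw
  have hV0 : V 0 = 0 := by
    simp [V]
  have hV : ∀ x u, V x ≤ ‖x‖ ^ 2 + ‖u‖ ^ 2 + V (A' x + B' u) := by
    intro y u
    have h1 := riccati_completion_of_squares hP hR (U *ᵥ y.ofLp) u.ofLp
    have hG : (Bᵀ * P * B + 1).PosSemidef := by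
      have := hP.posSemidef.conjTranspose_mul_mul_same B
      rw [Matrix.conjTranspose_eq_transpose_of_trivial] at this
      exact this.add Matrix.PosSemidef.one
    have h2 := hG.dotProduct_mulVec_nonneg (u.ofLp - lqrGain A B 1 P *ᵥ U *ᵥ y.ofLp)
    rw [star_trivial] at h2
    have h3 : U *ᵥ (Matrix.toEuclideanLin (Uᵀ * A * U) y + Matrix.toEuclideanLin (Uᵀ * B) u).ofLp
        = A *ᵥ U *ᵥ y.ofLp + B *ᵥ u.ofLp := by
      rw [WithLp.ofLp_add, Matrix.ofLp_toLpLin, Matrix.ofLp_toLpLin, Matrix.toLin'_apply,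
        Matrix.toLin'_apply, Matrix.mulVec_add, ← Matrix.mulVec_mulVec, ← Matrix.mulVec_mulVec,
        ← Matrix.mulVec_mulVec, hVU, hVU]
    have h4 : (U *ᵥ y.ofLp) ⬝ᵥ (U *ᵥ y.ofLp) = ‖y‖ ^ 2 := by
      rw [dotProduct_self_eq_norm_sq, norm_mulVec_of_transpose_mul_eq_one hU.transpose_mul]
    have h5 : u.ofLp ⬝ᵥ u.ofLp = ‖u‖ ^ 2 := dotProduct_self_eq_norm_sq _
    simp only [V, A', B', h3]
    rw [h4, h5] at h1
    linarith
  have main := cost_le_of_steering hM hμ hμM hA' hT hT0 hTk hidem hdown hup hess hsurj hsurjB hV0 hV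
    (WithLp.toLp 2 (Uᵀ *ᵥ x))
  simp only [V, hVU] at main
  rwa [norm_mulVec_of_transpose_mul_eq_one hUt, ← dotProduct_self_eq_norm_sq] at main

/-! ### From a Lyapunov function to spectral radius and resolvent -/

/-- Real and imaginary parts decouple under a real matrix, so inequalities between real quadratic
forms carry over to complex vectors. -/
theorem norm_sq_toComplex_mulVec {n : ℕ} (X : Matrix (Fin n) (Fin n) ℝ) (v : Fin n → ℂ) :
    ‖WithLp.toLp 2 (toComplex X *ᵥ v)‖ ^ 2 = (X *ᵥ fun a => (v a).re) ⬝ᵥ (X *ᵥ fun a => (v a).re) +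
      (X *ᵥ fun a => (v a).im) ⬝ᵥ (X *ᵥ fun a => (v a).im) := by
  rw [EuclideanSpace.norm_sq_eq, dotProduct, dotProduct, ← Finset.sum_add_distrib]
  refine Finset.sum_congr rfl fun a _ => ?_
  have hre : ((toComplex X *ᵥ v) a).re = (X *ᵥ fun a => (v a).re) a := by
    simp [toComplex, Matrix.mulVec, dotProduct]
  have him : ((toComplex X *ᵥ v) a).im = (X *ᵥ fun a => (v a).im) a := by
    simp [toComplex, Matrix.mulVec, dotProduct]
  rw [← hre, ← him, Complex.sq_norm, Complex.normSq_apply]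

theorem toComplex_mulVec_mulVec {n : ℕ} (S X : Matrix (Fin n) (Fin n) ℝ) (v : Fin n → ℂ) :
    toComplex S *ᵥ toComplex X *ᵥ v = toComplex (S * X) *ᵥ v := by
  rw [Matrix.mulVec_mulVec]
  congr 1
  exact (Matrix.map_mul (f := Complex.ofRealHom)).symm

open scoped MatrixOrder in
theorem exists_eq_transpose_mul_self {n : ℕ} {P : Matrix (Fin n) (Fin n) ℝ} (hP : P.PosSemidef) :
    ∃ S : Matrix (Fin n) (Fin n) ℝ, P = Sᵀ * S := by
  obtain ⟨S, hS⟩ := CStarAlgebra.nonneg_iff_eq_star_mul_self.1 hP.nonneg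
  refine ⟨S, ?_⟩
  rwa [Matrix.star_eq_conjTranspose, Matrix.conjTranspose_eq_transpose_of_trivial] at hS

/-- A Lyapunov function `x ↦ x'Px` with `I ≤ P ≤ β I` that decreases by at least `|x|²` in each step
bounds the resolvent outside a disc of radius less than one. -/
theorem norm_le_of_lyapunov {n : ℕ} {X P : Matrix (Fin n) (Fin n) ℝ} {β : ℝ} (hβ : 1 ≤ β)
    (hP : P.PosSemidef) (hX : ∀ x, (X *ᵥ x) ⬝ᵥ P *ᵥ (X *ᵥ x) + x ⬝ᵥ x ≤ x ⬝ᵥ P *ᵥ x)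
    (hPβ : ∀ x, x ⬝ᵥ P *ᵥ x ≤ β * (x ⬝ᵥ x)) {z : ℂ} (hz : 1 - 1 / (2 * β) ≤ ‖z‖)
    (v : Fin n → ℂ) :
    (‖z‖ - (1 - 1 / (2 * β))) * ‖WithLp.toLp 2 v‖ ≤
      β * ‖WithLp.toLp 2 ((z • (1 : Matrix (Fin n) (Fin n) ℂ) - toComplex X) *ᵥ v)‖ := by
  obtain ⟨S, hS⟩ := exists_eq_transpose_mul_self hP
  have hq : ∀ x, (S *ᵥ x) ⬝ᵥ (S *ᵥ x) = x ⬝ᵥ P *ᵥ x := fun x => by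
    rw [hS, ← Matrix.mulVec_mulVec, Matrix.dotProduct_mulVec x, Matrix.vecMul_transpose]
  have hnn : ∀ x : Fin n → ℝ, 0 ≤ x ⬝ᵥ x := fun x => by
    rw [dotProduct_self_eq_norm_sq]; positivity
  set s := 1 - 1 / (2 * β) with hs
  have hβ0 : 0 < β := by linarith
  have hs0 : 0 ≤ s := by
    rw [hs, sub_nonneg, div_le_one (by positivity)]; linarith
  -- The Lyapunov decrease gives the squared contraction factor `1 - 1/β`; `s` bounds its root from
  -- above.
  have hs2 : 1 - 1 / β ≤ s ^ 2 := by
    have : s ^ 2 = 1 - 1 / β + (1 / (2 * β)) ^ 2 := by rw [hs]; field_simp; ring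
    rw [this]
    exact le_add_of_nonneg_right (sq_nonneg _)
  have hlow : ∀ v : Fin n → ℂ, ‖WithLp.toLp 2 v‖ ≤ ‖WithLp.toLp 2 (toComplex S *ᵥ v)‖ := fun v => by
    have h1 := norm_sq_toComplex_mulVec 1 v
    rw [show toComplex (1 : Matrix (Fin n) (Fin n) ℝ) = 1 from
      Matrix.map_one _ Complex.ofReal_zero Complex.ofReal_one] at h1
    simp only [Matrix.one_mulVec] at h1
    rw [← sq_le_sq₀ (norm_nonneg _) (norm_nonneg _), h1, norm_sq_toComplex_mulVec, hq, hq]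
    have hle : ∀ x, x ⬝ᵥ x ≤ x ⬝ᵥ P *ᵥ x := fun x => by
      have := hP.dotProduct_mulVec_nonneg (X *ᵥ x)
      rw [star_trivial] at this
      linarith [hX x]
    exact add_le_add (hle _) (hle _)
  -- The sharp constant is `√β`; `β ≥ 1` allows the simpler `β`.
  have hupp : ∀ v : Fin n → ℂ,
      ‖WithLp.toLp 2 (toComplex S *ᵥ v)‖ ≤ β * ‖WithLp.toLp 2 v‖ := fun v => by
    have h1 := norm_sq_toComplex_mulVec 1 v
    rw [show toComplex (1 : Matrix (Fin n) (Fin n) ℝ) = 1 from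
      Matrix.map_one _ Complex.ofReal_zero Complex.ofReal_one] at h1
    simp only [Matrix.one_mulVec] at h1
    rw [← sq_le_sq₀ (norm_nonneg _) (by positivity), mul_pow, h1, norm_sq_toComplex_mulVec, hq, hq,
      mul_add]
    have hle : ∀ x, x ⬝ᵥ P *ᵥ x ≤ β ^ 2 * (x ⬝ᵥ x) := fun x => (hPβ x).trans
      (mul_le_mul_of_nonneg_right (le_self_pow₀ hβ two_ne_zero) (hnn x))
    exact add_le_add (hle _) (hle _)
  have hcontr : ∀ v : Fin n → ℂ, ‖WithLp.toLp 2 (toComplex S *ᵥ toComplex X *ᵥ v)‖ ≤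
      s * ‖WithLp.toLp 2 (toComplex S *ᵥ v)‖ := fun v => by
    rw [toComplex_mulVec_mulVec, ← sq_le_sq₀ (norm_nonneg _) (by positivity), mul_pow,
      norm_sq_toComplex_mulVec, norm_sq_toComplex_mulVec, mul_add]
    have hle : ∀ x, ((S * X) *ᵥ x) ⬝ᵥ ((S * X) *ᵥ x) ≤ s ^ 2 * ((S *ᵥ x) ⬝ᵥ (S *ᵥ x)) := fun x => by
      rw [← Matrix.mulVec_mulVec, hq, hq]
      have h1 : (1 / β) * (x ⬝ᵥ P *ᵥ x) ≤ x ⬝ᵥ x := by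
        rw [one_div, inv_mul_le_iff₀ hβ0]; exact hPβ x
      have h2 : 0 ≤ x ⬝ᵥ P *ᵥ x := by rw [← hq]; exact hnn _
      have h3 := mul_le_mul_of_nonneg_right hs2 h2
      linarith [hX x]
    exact add_le_add (hle _) (hle _)
  set w := (z • (1 : Matrix (Fin n) (Fin n) ℂ) - toComplex X) *ᵥ v with hw
  have hzv : WithLp.toLp 2 (z • (toComplex S *ᵥ v)) = WithLp.toLp 2 (toComplex S *ᵥ toComplex X *ᵥ v)
      + WithLp.toLp 2 (toComplex S *ᵥ w) := by
    rw [← WithLp.toLp_add, ← Matrix.mulVec_add, ← Matrix.mulVec_smul, hw, Matrix.sub_mulVec,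
      Matrix.smul_mulVec, Matrix.one_mulVec, add_sub_cancel]
  -- From `z S v = S X v + S w` and the contraction, `(‖z‖ - s) ‖S v‖ ≤ ‖S w‖`.
  have htri := norm_add_le (WithLp.toLp 2 (toComplex S *ᵥ toComplex X *ᵥ v))
    (WithLp.toLp 2 (toComplex S *ᵥ w))
  rw [← hzv, WithLp.toLp_smul, norm_smul] at htri
  calc (‖z‖ - s) * ‖WithLp.toLp 2 v‖ ≤ (‖z‖ - s) * ‖WithLp.toLp 2 (toComplex S *ᵥ v)‖ :=
        mul_le_mul_of_nonneg_left (hlow v) (sub_nonneg.2 hz)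
    _ ≤ ‖WithLp.toLp 2 (toComplex S *ᵥ w)‖ := by linarith [hcontr v]
    _ ≤ β * ‖WithLp.toLp 2 w‖ := hupp w

theorem det_smul_one_sub_ne_zero {n : ℕ} {X P : Matrix (Fin n) (Fin n) ℝ} {β : ℝ} (hβ : 1 ≤ β)
    (hP : P.PosSemidef) (hX : ∀ x, (X *ᵥ x) ⬝ᵥ P *ᵥ (X *ᵥ x) + x ⬝ᵥ x ≤ x ⬝ᵥ P *ᵥ x)
    (hPβ : ∀ x, x ⬝ᵥ P *ᵥ x ≤ β * (x ⬝ᵥ x)) {z : ℂ} (hz : 1 - 1 / (2 * β) < ‖z‖) :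
    (z • (1 : Matrix (Fin n) (Fin n) ℂ) - toComplex X).det ≠ 0 := by
  intro h
  obtain ⟨v, hv, h0⟩ := Matrix.exists_mulVec_eq_zero_iff.2 h
  have h1 := norm_le_of_lyapunov hβ hP hX hPβ hz.le v
  rw [h0, WithLp.toLp_zero, norm_zero, mul_zero] at h1
  have h2 : 0 < ‖WithLp.toLp 2 v‖ := norm_pos_iff.2 fun h => hv (by simpa using h)
  have := mul_pos (sub_pos.2 hz) h2
  linarith

theorem specRadius_le_of_lyapunov {n : ℕ} {X P : Matrix (Fin n) (Fin n) ℝ} {β : ℝ} (hβ : 1 ≤ β)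
    (hP : P.PosSemidef) (hX : ∀ x, (X *ᵥ x) ⬝ᵥ P *ᵥ (X *ᵥ x) + x ⬝ᵥ x ≤ x ⬝ᵥ P *ᵥ x)
    (hPβ : ∀ x, x ⬝ᵥ P *ᵥ x ≤ β * (x ⬝ᵥ x)) : specRadius X ≤ 1 - 1 / (2 * β) := by
  have hs0 : 0 ≤ 1 - 1 / (2 * β) := by
    rw [sub_nonneg, div_le_one (by positivity)]; linarith
  refine ENNReal.toReal_le_of_le_ofReal hs0 ?_
  refine iSup₂_le fun z hz => ?_
  rw [← enorm_eq_nnnorm, ← ofReal_norm]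
  refine ENNReal.ofReal_le_ofReal ?_
  by_contra hlt
  refine hz ?_
  rw [spectrum.mem_resolventSet_iff, Algebra.algebraMap_eq_smul_one, Matrix.isUnit_iff_isUnit_det]
  exact (det_smul_one_sub_ne_zero hβ hP hX hPβ (not_le.1 hlt)).isUnit

theorem hInfNorm_le_of_lyapunov {n : ℕ} {X P : Matrix (Fin n) (Fin n) ℝ} {β : ℝ} (hβ : 1 ≤ β)
    (hP : P.PosSemidef) (hX : ∀ x, (X *ᵥ x) ⬝ᵥ P *ᵥ (X *ᵥ x) + x ⬝ᵥ x ≤ x ⬝ᵥ P *ᵥ x)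
    (hPβ : ∀ x, x ⬝ᵥ P *ᵥ x ≤ β * (x ⬝ᵥ x)) : hInfNorm X ≤ ENNReal.ofReal (2 * β ^ 2) := by
  have hβ0 : 0 < β := by linarith
  refine iSup_le fun ⟨z, hz⟩ => ENNReal.ofReal_le_ofReal ?_
  have hlt : 1 - 1 / (2 * β) < ‖z‖ := by
    rw [hz, sub_lt_self_iff]; positivity
  have hdet := (det_smul_one_sub_ne_zero hβ hP hX hPβ hlt).isUnit
  rw [Matrix.l2_opNorm_def]
  refine ContinuousLinearMap.opNorm_le_bound _ (by positivity) fun w => ?_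
  -- On the unit circle the gap `‖z‖ - s` is `1/(2β)`, so the resolvent is at most `β · 2β`.
  have h1 := norm_le_of_lyapunov hβ hP hX hPβ hlt.le
    ((z • (1 : Matrix (Fin n) (Fin n) ℂ) - toComplex X)⁻¹ *ᵥ w.ofLp)
  rw [Matrix.mulVec_mulVec, Matrix.mul_nonsing_inv _ hdet, Matrix.one_mulVec, hz, sub_sub_cancel,
    one_div, inv_mul_le_iff₀ (by positivity)] at h1
  refine h1.trans (le_of_eq ?_)
  rw [WithLp.toLp_ofLp]
  ring

/-! ### Margins and absorption of constants -/

theorem margins_of_robustlyCoupled {n p : ℕ} {A : Matrix (Fin n) (Fin n) ℝ}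
    {B : Matrix (Fin n) (Fin p) ℝ} {P : Matrix (Fin n) (Fin n) ℝ} {M μ β : ℝ} (hM : 1 ≤ M)
    (hA : ‖A‖ ≤ M) (hB : ‖B‖ ≤ M) (hc : Controllable A B) (hr : RobustlyCoupled μ A B)
    (hP : P.PosDef) (hR : IsRiccatiSolution A B 1 1 P) (hβ1 : 1 ≤ β)
    (hβ : (ctrbIndex A B : ℝ) ^ 3 * (M ^ ctrbIndex A B) ^ 2 *
      ((3 * (M / μ)) ^ ctrbIndex A B) ^ 4 ≤ β) :
    specRadius (A + B * lqrGain A B 1 P) < 1 ∧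
      (1 - specRadius (A + B * lqrGain A B 1 P))⁻¹ ≤ 2 * β ^ 2 ∧
      hInfNorm (A + B * lqrGain A B 1 P) ≤ ENNReal.ofReal (2 * β ^ 2) := by
  have hnn : ∀ {k : ℕ} (x : Fin k → ℝ), 0 ≤ x ⬝ᵥ x := fun x => by
    rw [dotProduct_self_eq_norm_sq]; positivity
  have hPβ : ∀ x, x ⬝ᵥ P *ᵥ x ≤ β * (x ⬝ᵥ x) := fun x =>
    ((riccati_solution_le hM hA hB hc hr hP hR).2 x).trans
      (mul_le_mul_of_nonneg_right hβ (hnn x))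
  have hX : ∀ x, ((A + B * lqrGain A B 1 P) *ᵥ x) ⬝ᵥ P *ᵥ ((A + B * lqrGain A B 1 P) *ᵥ x)
      + x ⬝ᵥ x ≤ x ⬝ᵥ P *ᵥ x := fun x => by
    -- At the optimal input the square vanishes, leaving `V x = |x|² + |Kx|² + V (Xx)`.
    have h1 := riccati_completion_of_squares hP hR x (lqrGain A B 1 P *ᵥ x)
    rw [sub_self, Matrix.mulVec_zero, dotProduct_zero, add_zero, Matrix.mulVec_mulVec,
      ← Matrix.add_mulVec] at h1
    linarith [hnn (lqrGain A B 1 P *ᵥ x)]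
  have h1 := specRadius_le_of_lyapunov hβ1 hP.posSemidef hX hPβ
  have hpos : 0 < 1 / (2 * β) := by positivity
  refine ⟨by linarith, ?_, hInfNorm_le_of_lyapunov hβ1 hP.posSemidef hX hPβ⟩
  have h2 : 1 / (2 * β) ≤ 1 - specRadius (A + B * lqrGain A B 1 P) := by linarith
  have h3 := inv_anti₀ hpos h2
  rw [one_div, inv_inv] at h3
  have := le_self_pow₀ hβ1 two_ne_zero
  linarith

/-- Constants to the power `κ` are absorbed into powers of `(c M / μ) ^ κ` or of
`M ^ κ * (M / μ) ^ κ`. -/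
theorem three_mul_pow_le {a q M : ℝ} {m κ : ℕ} (ha : 1 ≤ a) (haq : a ≤ q)
    (h3 : 3 ≤ (M * q) ^ m) : (3 * a) ^ κ ≤ (M ^ κ) ^ m * (q ^ κ) ^ (m + 1) := by
  have h0 : 0 ≤ q := by linarith
  calc (3 * a) ^ κ ≤ ((M * q) ^ m * q) ^ κ := by gcongr
    _ = (M ^ κ) ^ m * (q ^ κ) ^ (m + 1) := by
      rw [mul_pow, mul_pow, mul_pow, ← pow_mul, ← pow_mul, ← pow_mul, ← pow_mul, mul_assoc,
        ← pow_add, mul_comm m κ]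
      ring_nf

end LQR

theorem mainTheorem9 (c : ℝ) (hc : 1 < c) :
    ∃ F : MvPolynomial (Fin 3) ℝ,
      ∀ (n p : ℕ) (A : Matrix (Fin n) (Fin n) ℝ) (B : Matrix (Fin n) (Fin p) ℝ) (M μ : ℝ)
        (P : Matrix (Fin n) (Fin n) ℝ) (K : Matrix (Fin p) (Fin n) ℝ) (κ : ℕ),
        1 ≤ M → ‖A‖ ≤ M → ‖B‖ ≤ M →
        LQR.Controllable A B → LQR.RobustlyCoupled μ A B → κ = LQR.ctrbIndex A B →
        P.PosDef → LQR.IsRiccatiSolution A B 1 1 P → K = LQR.lqrGain A B 1 P →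
        LQR.specRadius (A + B * K) < 1 ∧
        ((1 - LQR.specRadius (A + B * K))⁻¹
            ≤ MvPolynomial.eval ![(c * M / μ) ^ κ, M ^ κ, (κ : ℝ)] F ∧
          LQR.hInfNorm (A + B * K)
            ≤ ENNReal.ofReal (MvPolynomial.eval ![(c * M / μ) ^ κ, M ^ κ, (κ : ℝ)] F)) ∧
        (c ≤ M ∨ c ≤ M / μ →
          (1 - LQR.specRadius (A + B * K))⁻¹
              ≤ MvPolynomial.eval ![(M / μ) ^ κ, M ^ κ, (κ : ℝ)] F ∧
          LQR.hInfNorm (A + B * K)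
              ≤ ENNReal.ofReal (MvPolynomial.eval ![(M / μ) ^ κ, M ^ κ, (κ : ℝ)] F)) := by
  -- `m` depends only on `c`, hence so does `F`, which is `2β²` with `(3M/μ)^κ` replaced by `(M^κ)^m
  -- (q^κ)^(m+1)`.
  obtain ⟨m, hm⟩ := pow_unbounded_of_one_lt (3 : ℝ) hc
  refine ⟨MvPolynomial.C 2 * (MvPolynomial.X 2 ^ 3 * MvPolynomial.X 1 ^ 2 *
    (MvPolynomial.X 1 ^ m * MvPolynomial.X 0 ^ (m + 1)) ^ 4) ^ 2, ?_⟩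
  rintro n p A B M μ P _ _ hM hA hB hctrb hr rfl hP hR rfl
  have hμ := hr.1
  have hμM := (LQR.riccati_solution_le hM hA hB hctrb hr hP hR).1
  have ha : 1 ≤ M / μ := (one_le_div hμ).2 hμM
  have hκ := hctrb.ctrbIndex_spec.1
  -- The same `F` serves both claims, with `q = cM/μ` and with `q = M/μ`.
  have key : ∀ q, M / μ ≤ q → c ≤ M * q → _ := fun q hq hcq => by
    have h3 : 3 ≤ (M * q) ^ m := hm.le.trans (pow_le_pow_left₀ (by linarith) hcq m)
    have h1 := LQR.three_mul_pow_le (κ := LQR.ctrbIndex A B) ha hq h3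
    have hκ1 : (1 : ℝ) ≤ LQR.ctrbIndex A B := by exact_mod_cast hκ
    have hle : (LQR.ctrbIndex A B : ℝ) ^ 3 * (M ^ LQR.ctrbIndex A B) ^ 2 *
        ((3 * (M / μ)) ^ LQR.ctrbIndex A B) ^ 4 ≤ (LQR.ctrbIndex A B : ℝ) ^ 3 *
        (M ^ LQR.ctrbIndex A B) ^ 2 * ((M ^ LQR.ctrbIndex A B) ^ m *
          (q ^ LQR.ctrbIndex A B) ^ (m + 1)) ^ 4 := by gcongr
    have hone : 1 ≤ (LQR.ctrbIndex A B : ℝ) ^ 3 * (M ^ LQR.ctrbIndex A B) ^ 2 *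
        ((3 * (M / μ)) ^ LQR.ctrbIndex A B) ^ 4 :=
      one_le_mul_of_one_le_of_one_le (one_le_mul_of_one_le_of_one_le (one_le_pow₀ hκ1)
        (one_le_pow₀ (one_le_pow₀ hM))) (one_le_pow₀ (one_le_pow₀ (by linarith)))
    exact LQR.margins_of_robustlyCoupled hM hA hB hctrb hr hP hR (hone.trans hle) hle
  simp only [map_mul, map_pow, MvPolynomial.eval_C, MvPolynomial.eval_X, Matrix.cons_val]
  have e1 : M / μ ≤ c * M / μ := by
    rw [mul_div_assoc]; exact le_mul_of_one_le_left (by linarith) hc.le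
  have e2 : c ≤ M * (c * M / μ) := by
    rw [mul_div_assoc]
    have : c ≤ c * (M / μ) := le_mul_of_one_le_right (by linarith) ha
    exact this.trans (le_mul_of_one_le_left (by linarith) hM)
  refine ⟨(key _ e1 e2).1, (key _ e1 e2).2, fun h => (key (M / μ) le_rfl ?_).2⟩
  -- One of the factors `M`, `M/μ` is at least `c` and the other at least `1`, so `c ≤ M · (M/μ)`.
  rcases h with h | h
  · exact h.trans (le_mul_of_one_le_right (by linarith) ha)
  · exact h.trans (le_mul_of_one_le_left (by linarith) hM)
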